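/- Graphs are finite and undirected, without parallel edges; loops are allowed. For a graph $G$ let $G^\circ$ be $G$ with a loop added at every vertex that has none. For a graph $H$, $X\subseteq V(H)$ and $e\in E(H)$, let $\gamma^X_e\subseteq E(H)$ be $\{e\}$ if all ends of $e$ lie in $X$, and otherwise the set of all edges with at least one end in the connected component of $H\setminus X$ that contains the ends of $e$ outside $X$. For $k,q\ge 1$, the $q$-placement $k$-cops-and-robber game on $H$ is played as follows. Cop positions are sets $X\subseteq V(H)$ with $|X|\le k$, robber positions are edges of $H$. Initially $X_0=\emptyset$, the robber chooses an edge $e_0$, and no placement has been made. In round $i\ge 1$ the cops move from $X_{i-1}$ to some $X_i\subseteq X_{i-1}$ (not counted), or, if fewer than $q$ placements have been made so far, to $X_i=X_{i-1}\cup\{v\}$ for some vertex $v$ (counted as one placement). The robber, who is on $e_{i-1}$, then moves to some $e_i\in\gamma^{X_{i-1}\cap X_i}_{e_{i-1}}$. The cops win in round $i$ if all ends of $e_i$ lie in $X_i$. If $H$ has no edge, the cops win immediately. A cop strategy is a map $\sigma$ assigning to each pair $(X,e)$ of a cop position and an edge a cop position, with $\sigma(X,e)=\sigma(X,f)$ whenever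 $f\in\gamma^X_e$. It is winning if, against every play of the robber, the cops following $\sigma$ make only legal moves and win after finitely many rounds. A tree decomposition of $G$ consists of a finite tree $T$ with root $r$ and bags $\beta(t)\subseteq V(G)$, $t\in V(T)$, such that every vertex lies in some bag, all ends of every edge lie in a common bag, and for every vertex $v$ the nodes $t$ with $v\in\beta(t)$ induce a connected subgraph of $T$. Its width is $\max_{t}|\beta(t)|-1$. Its depth is the maximum, over all leaves $\ell$ of $T$ (the only node, if $T$ has just one node), of $\bigl|\bigcup_{t\in P_\ell}\beta(t)\bigr|$, where $P_\ell$ is the path from $r$ to $\ell$. **Theorem.** Let $G$ be a graph and let $k,q\ge 1$. If there is a cop strategy $\sigma$ that is winning in the $q$-placement $k$-cops-and-robber game on $G^\circ$, then $G$ has a tree decomposition of width at most $k-1$ (in particular, of width at most $k$) and depth at most $q$. -/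

import Mathlib

/-- An undirected graph with vertex set `V`, in which loops are allowed and parallel edges are not.
An edge is an unordered pair `s(u, v)`, that is, a set of one or two vertices. -/
structure LoopGraph (V : Type*) where
  edges : Set (Sym2 V)

namespace LoopGraph

variable {V : Type*}

/-- The graph `G°`, obtained from `G` by adding a loop at every vertex that has none. -/
def addLoops (G : LoopGraph V) : LoopGraph V where
  edges := G.edges ∪ {e | ∃ v : V, e = s(v, v)}

/-- The graph `G` without the vertices in `X` (loops are irrelevant for connectedness). -/
def deleteVerts (G : LoopGraph V) (X : Set V) : SimpleGraph {v : V // v ∉ X} :=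
  (SimpleGraph.fromEdgeSet G.edges).induce {v : V | v ∉ X}

/-- The edge component `γ_e^X` of the edge `e` with respect to the cop position `X`.
If both ends of `e` lie in `X`, it is `{e}`. Otherwise it consists of all edges (among them `e`)
with at least one end in the connected component of `G ∖ X` that contains the ends of `e`
outside `X`. -/
def edgeComponent (G : LoopGraph V) (X : Set V) (e : Sym2 V) : Set (Sym2 V) :=
  {f | f ∈ G.edges ∧ (f = e ∨
    ∃ (x : {v : V // v ∉ X}) (y : {v : V // v ∉ X}),
      x.1 ∈ e ∧ y.1 ∈ f ∧ (G.deleteVerts X).Reachable x y)}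

end LoopGraph

/-- The cop positions: sets of at most `k` vertices. -/
def CopPos (V : Type*) (k : ℕ) : Type _ := {X : Finset V // X.card ≤ k}

/-- The position with no cop on the graph. -/
def CopPos.empty (V : Type*) (k : ℕ) : CopPos V k := ⟨∅, by simp⟩

/-- A cop strategy for `k` cops on `G`: from the cop position and the position of the robber (an
edge) it determines the next cop position. It depends on the robber's edge only through the edge
component in which the robber is. -/
structure CopStrategy {V : Type*} (G : LoopGraph V) (k : ℕ) where
  move : CopPos V k → G.edges → CopPos V k
  move_eq : ∀ (X : CopPos V k) (e f : G.edges),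
    f.1 ∈ G.edgeComponent (X.1 : Set V) e.1 → move X e = move X f

namespace CopStrategy

variable {V : Type*} {G : LoopGraph V} {k : ℕ}

/-- The edges to which the robber may move from `e` while the cops, following `σ`, move from `X`
to `σ(X, e)`: those he reaches without passing through a vertex of `X ∩ σ(X, e)`. -/
def robberMoves (σ : CopStrategy G k) (X : CopPos V k) (e : G.edges) : Set G.edges :=
  {f | f.1 ∈ G.edgeComponent ((X.1 : Set V) ∩ ((σ.move X e).1 : Set V)) e.1}

/-- `σ.WinsFrom q j X e`: in the `q`-placement game, in which `j` placements have been made so far,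
with the cops on `X` and the robber on the edge `e`, the cops who follow `σ` make only legal moves
and capture the robber after finitely many rounds, whatever the robber does.
A legal move either removes cops (and is not counted) or places one more cop (and is counted), the
latter only while fewer than `q` placements have been made. -/
inductive WinsFrom (σ : CopStrategy G k) (q : ℕ) : ℕ → CopPos V k → G.edges → Prop
  | captured (j : ℕ) (X : CopPos V k) (e : G.edges) (h : ∀ v ∈ e.1, v ∈ X.1) :
      WinsFrom σ q j X e
  | remove (j : ℕ) (X : CopPos V k) (e : G.edges)
      (hsub : (σ.move X e).1 ⊆ X.1)
      (hwin : ∀ f ∈ σ.robberMoves X e, WinsFrom σ q j (σ.move X e) f) :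
      WinsFrom σ q j X e
  | place (j : ℕ) (X : CopPos V k) (e : G.edges) (v : V) (hj : j < q)
      (hins : ((σ.move X e).1 : Set V) = insert v (X.1 : Set V))
      (hwin : ∀ f ∈ σ.robberMoves X e, WinsFrom σ q (j + 1) (σ.move X e) f) :
      WinsFrom σ q j X e

/-- `σ` is a winning strategy in the `q`-placement `k`-cops-and-robber game on `G`: it wins from
the start, with no cop on the graph and no placement made, against every initial edge that the
robber may choose. (If `G` has no edge, the cops win at once.) -/
def IsWinning (σ : CopStrategy G k) (q : ℕ) : Prop :=
  ∀ e : G.edges, σ.WinsFrom q 0 (CopPos.empty V k) e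

end CopStrategy

/-- A (rooted, finite) tree decomposition of `G`. -/
structure TreeDecomposition {V : Type*} (G : LoopGraph V) where
  /-- the nodes of the tree -/
  Node : Type
  [fintypeNode : Fintype Node]
  tree : SimpleGraph Node
  isTree : tree.IsTree
  root : Node
  bag : Node → Finset V
  /-- every vertex lies in a bag -/
  vertex_mem : ∀ v : V, ∃ t, v ∈ bag t
  /-- every edge has all its ends in a common bag -/
  edge_mem : ∀ e ∈ G.edges, ∃ t, ∀ v ∈ e, v ∈ bag t
  /-- the nodes whose bags contain `v` induce a connected subgraph of the tree -/
  connected : ∀ v : V, (tree.induce {t | v ∈ bag t}).Connected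

namespace TreeDecomposition

variable {V : Type*} {G : LoopGraph V}

attribute [instance] TreeDecomposition.fintypeNode

/-- The width: the largest size of a bag, minus one. -/
def width (D : TreeDecomposition G) : ℤ :=
  ((Finset.univ.sup fun t => (D.bag t).card : ℕ) : ℤ) - 1

/-- The leaves are the nodes with exactly one neighbour; if the tree has only one node, that node
counts as a leaf. -/
def IsLeaf (D : TreeDecomposition G) (t : D.Node) : Prop :=
  (D.tree.neighborSet t).ncard ≤ 1

/-- The union of the bags on the path from the root to `t`. -/
def pathUnion (D : TreeDecomposition G) (t : D.Node) : Set V :=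
  {v | ∃ p : D.tree.Walk D.root t, p.IsPath ∧ ∃ s ∈ p.support, v ∈ D.bag s}

open Classical in
/-- The depth: the largest size, over all leaves, of the union of the bags on the path from the
root to the leaf. -/
noncomputable def depth (D : TreeDecomposition G) : ℕ :=
  (Finset.univ.filter fun t => D.IsLeaf t).sup fun t => (D.pathUnion t).ncard

end TreeDecomposition

/-! A winning strategy may give up vertices and let the robber return, while a tree decomposition
amounts to a monotone strategy. The proof trades one for the other without extra cops or placements.
`Solvable` is the monotone game on a vertex set `U` guarded by its neighbourhood `N(U)`. By
induction along the given strategy, `WinsFrom.exists_extends` encloses each robber territory in a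
solvable set `W`; the cops of `X` in the closed neighbourhood `N[W]` and the placements left pay for
`N(W)` and for the placements on `W`. Since `W` may exceed the territory, removing cops costs
nothing.

A placement leading to `X'` is handled by `exists_extends_of_place`. Among all `W ⊇ U` cut by some
`B` into pieces of the solvable sets given by induction, one minimises `|N(W)| + |B| - |X' ∩ N[W]|`.
Comparison with exchanged pairs (`Splits.exchange`, `card_exchange_le`) shows that the placements
suffice and that the pieces have smallest possible neighbourhoods, so that by submodularity they
inherit solvability (`Solvable.restrict`).

With no cops on the graph, `N(W)` is empty, so the whole vertex set is solvable. The sets `N(U) ∪ B`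
are then the bags, and each step down the tree adds at most `|B|` new vertices to the path union. -/

namespace SimpleGraph

/-! ### Neighbourhoods and monotone solvability -/

variable {V : Type*} [Fintype V] [DecidableEq V]

open Classical in
/-- The vertices outside `U` with a neighbour in `U`. -/
noncomputable def outerNbrs (H : SimpleGraph V) (U : Finset V) : Finset V :=
  Finset.univ.filter fun y => y ∉ U ∧ ∃ x ∈ U, H.Adj x y

variable {H : SimpleGraph V}

theorem mem_outerNbrs {U : Finset V} {y : V} :
    y ∈ H.outerNbrs U ↔ y ∉ U ∧ ∃ x ∈ U, H.Adj x y := by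
  simp [outerNbrs]

theorem outerNbrs_submodular (C Q : Finset V) :
    (H.outerNbrs (C ∪ Q)).card + (H.outerNbrs (C ∩ Q)).card ≤
      (H.outerNbrs C).card + (H.outerNbrs Q).card := by
  rw [← Finset.card_union_add_card_inter, ← Finset.card_union_add_card_inter (H.outerNbrs C)]
  apply Nat.add_le_add <;> apply Finset.card_le_card <;> intro y hy <;>
    simp only [Finset.mem_union, Finset.mem_inter, mem_outerNbrs] at hy ⊢ <;> grind

variable (H) in
/-- `H.Solvable k d U`: if the cops occupy the neighbourhood of `U` and the robber is in `U`, then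
`k` cops catch him monotonically with at most `d` further placements. First the cops occupy `B`;
then the robber is in one of the sets `P x`, which are unions of components of `U \ B`. -/
inductive Solvable (k : ℕ) : ℕ → Finset V → Prop
  | intro (d : ℕ) (U B : Finset V) (P : V → Finset V) (hBU : B ⊆ U)
      (hk : (H.outerNbrs U).card + B.card ≤ k) (hd : B.card ≤ d)
      (hmem : ∀ x ∈ U \ B, x ∈ P x) (hsub : ∀ x ∈ U \ B, P x ⊆ U \ B)
      (hclosed : ∀ x ∈ U \ B, Disjoint (H.outerNbrs (P x)) (U \ B))
      (hP : ∀ x ∈ U \ B, Solvable k (d - B.card) (P x)) : Solvable k d U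

theorem Solvable.empty (k d : ℕ) : H.Solvable k d ∅ := by
  refine .intro d ∅ ∅ (fun _ => ∅) (by simp) ?_ (by simp) (by simp) (by simp) (by simp) (by simp)
  have : H.outerNbrs ∅ = ∅ := by ext; simp [mem_outerNbrs]
  simp [this]

theorem Solvable.mono {k d d' : ℕ} {U : Finset V} (h : H.Solvable k d U) (hd : d ≤ d') :
    H.Solvable k d' U := by
  induction h generalizing d' with
  | intro d U B P hBU hk hB hmem hsub hclosed hP ih =>
    exact .intro d' U B P hBU hk (hB.trans hd) hmem hsub hclosed
      fun x hx => ih x hx (Nat.sub_le_sub_right hd _)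

/-- Solvability passes to a subset whose neighbourhood is smallest among all sets in between. -/
theorem Solvable.restrict {k d : ℕ} {U Q : Finset V} (h : H.Solvable k d U) (hQU : Q ⊆ U)
    (hmin : ∀ C, Q ⊆ C → C ⊆ U → (H.outerNbrs Q).card ≤ (H.outerNbrs C).card) :
    H.Solvable k d Q := by
  induction h generalizing Q with
  | intro d U B P hBU hk hB hmem hsub hclosed hP ih =>
    have hcard : (B ∩ Q).card ≤ B.card := Finset.card_le_card Finset.inter_subset_left
    have hx' : ∀ x ∈ Q \ (B ∩ Q), x ∈ U \ B := by
      intro x hx; simp only [Finset.mem_sdiff, Finset.mem_inter] at hx ⊢; grind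
    refine .intro d Q (B ∩ Q) (fun x => P x ∩ Q) Finset.inter_subset_right ?_
      (hcard.trans hB) ?_ ?_ ?_ ?_
    · have := hmin U hQU subset_rfl
      omega
    · intro x hx
      exact Finset.mem_inter.2 ⟨hmem x (hx' x hx), (Finset.mem_sdiff.1 hx).1⟩
    · intro x hx y hy
      have := hsub x (hx' x hx)
      grind
    · intro x hx
      have := hclosed x (hx' x hx)
      rw [Finset.disjoint_left] at this ⊢
      intro y hy hyQ
      apply this (a := y)
      · rw [mem_outerNbrs] at hy ⊢; grind
      · grind
    · intro x hx
      have hPU := hsub x (hx' x hx)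
      refine (ih x (hx' x hx) Finset.inter_subset_left ?_).mono (Nat.sub_le_sub_left hcard _)
      intro C hC hCP
      have hCQ : C ∩ Q = P x ∩ Q := by ext y; grind
      -- Submodularity transfers minimality from `Q` to `P x ∩ Q`: since `|N(C ∪ Q)| ≥ |N(Q)|`, it
      -- leaves `|N(C ∩ Q)| ≤ |N(C)|`.
      have h1 := outerNbrs_submodular (H := H) C Q
      have h2 := hmin (C ∪ Q) Finset.subset_union_right (by grind)
      rw [hCQ] at h1
      omega

/-! ### Extensions and the exchange argument -/

/-- The robber space `U` (with respect to the cops on `X`) extends to a set that is solvable with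
`m` placements, as measured relative to the number of cops on its closed neighbourhood. -/
def Extends (H : SimpleGraph V) (k : ℕ) (X : Finset V) (m : ℕ) (U W : Finset V) : Prop :=
  U ⊆ W ∧ (H.outerNbrs W).card ≤ (X ∩ (W ∪ H.outerNbrs W)).card ∧
    ∃ d, H.Solvable k d W ∧
      (H.outerNbrs W).card + d ≤ (X ∩ (W ∪ H.outerNbrs W)).card + m

theorem Extends.mono {k m : ℕ} {X X' U U' W : Finset V} (h : H.Extends k X' m U' W)
    (hU : U ⊆ U') (hX : X' ⊆ X) : H.Extends k X m U W := by
  obtain ⟨h1, h2, d, h3, h4⟩ := h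
  have : (X' ∩ (W ∪ H.outerNbrs W)).card ≤ (X ∩ (W ∪ H.outerNbrs W)).card :=
    Finset.card_le_card (Finset.inter_subset_inter_right hX)
  exact ⟨hU.trans h1, by omega, d, h3, by omega⟩

/-- Every vertex of `W \ B` lies in a union of components of `W \ B` inside a member of `𝒲`. -/
def Splits (H : SimpleGraph V) (𝒲 : Set (Finset V)) (W B : Finset V) : Prop :=
  B ⊆ W ∧ ∀ x ∈ W \ B, ∃ P : Finset V, x ∈ P ∧ P ⊆ W \ B ∧
    Disjoint (H.outerNbrs P) (W \ B) ∧ ∃ Y ∈ 𝒲, P ⊆ Y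

/-- `C` becomes a piece of its own, separated from the rest because its neighbours in `W` join the
cut. The other pieces lose `C` and `N(C)`. -/
theorem Splits.exchange {𝒲 : Set (Finset V)} {W B C Y : Finset V} (h : H.Splits 𝒲 W B)
    (hY : Y ∈ 𝒲) (hC : C ⊆ Y) :
    H.Splits 𝒲 (W ∪ C) ((B \ C) ∪ (H.outerNbrs C ∩ W)) := by
  refine ⟨by have := h.1; grind, fun x hx => ?_⟩
  by_cases hxC : x ∈ C
  · refine ⟨C, hxC, fun y hy => ?_, ?_, Y, hY, hC⟩
    · simp only [Finset.mem_sdiff, Finset.mem_union, Finset.mem_inter, mem_outerNbrs]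
      grind
    · rw [Finset.disjoint_left]
      intro y hy
      have := mem_outerNbrs.1 hy
      grind
  · obtain ⟨P, hxP, hPW, hcl, Z, hZ, hPZ⟩ := h.2 x (by grind)
    refine ⟨P \ (C ∪ H.outerNbrs C), by grind, by grind, ?_, Z, hZ, by grind⟩
    rw [Finset.disjoint_left] at hcl ⊢
    intro y hy hyW
    obtain ⟨hyP, z, hz, hzy⟩ := mem_outerNbrs.1 hy
    have hyC : y ∉ C := by
      intro hyC
      have : z ∈ H.outerNbrs C := mem_outerNbrs.2 ⟨by grind, y, hyC, hzy.symm⟩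
      grind
    have hyP' : y ∉ P := by grind
    exact hcl (mem_outerNbrs.2 ⟨hyP', z, by grind, hzy⟩) (by grind)

/-- The new boundary and cut lie in `N(C)` together with the part of the old `N(W) ∪ B` outside
`N[C]`. -/
theorem card_exchange_le {W B : Finset V} (C : Finset V) (hB : B ⊆ W) :
    (H.outerNbrs (W ∪ C)).card + ((B \ C) ∪ (H.outerNbrs C ∩ W)).card ≤
      (H.outerNbrs C).card + ((H.outerNbrs W ∪ B) \ (C ∪ H.outerNbrs C)).card := by
  rw [← Finset.card_union_of_disjoint, ← Finset.card_union_of_disjoint]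
  · apply Finset.card_le_card
    intro y
    simp only [Finset.mem_union, Finset.mem_inter, Finset.mem_sdiff, mem_outerNbrs]
    grind
  · rw [Finset.disjoint_left]; grind
  · rw [Finset.disjoint_left]
    intro y hy
    have := (mem_outerNbrs.1 hy).1
    grind

theorem card_outerNbrs_add {W B : Finset V} (hB : B ⊆ W) :
    (H.outerNbrs W).card + B.card = (H.outerNbrs W ∪ B).card := by
  rw [Finset.card_union_of_disjoint]
  rw [Finset.disjoint_left]
  intro y hy
  have := (mem_outerNbrs.1 hy).1
  grind

/-- The placement of a cop on `v`, given that the claim holds for all components after it. -/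
theorem exists_extends_of_place {k m : ℕ} {X U : Finset V} {v : V}
    (hk : (insert v X).card ≤ k) (hUX : Disjoint U X) (hNU : H.outerNbrs U ⊆ X)
    (P : V → Finset V) (hmem : ∀ x ∈ U \ {v}, x ∈ P x) (hsub : ∀ x ∈ U \ {v}, P x ⊆ U \ {v})
    (hN : ∀ x ∈ U \ {v}, H.outerNbrs (P x) ⊆ insert v X)
    (hP : ∀ x ∈ U \ {v}, ∃ W, H.Extends k (insert v X) m (P x) W) :
    ∃ W, H.Extends k X (m + 1) U W := by
  choose! Y hY using hP
  set X' := insert v X with hX'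
  set 𝒲 : Set (Finset V) := Y '' ↑(U \ {v}) with h𝒲
  let cl : Finset V → Finset V := fun W => W ∪ H.outerNbrs W
  let Φ : Finset V × Finset V → ℤ := fun p =>
    ((H.outerNbrs p.1).card : ℤ) + p.2.card - (X' ∩ cl p.1).card
  -- The starting pair is `(U, U ∩ {v})`; the intersection covers a placement outside `U`. Its
  -- boundary and cut lie in `X'`, hence `Φ ≤ 0`.
  let S : Set (Finset V × Finset V) := {p | U ⊆ p.1 ∧ H.Splits 𝒲 p.1 p.2}
  have h0 : (U, U ∩ {v}) ∈ S := by
    refine ⟨subset_rfl, Finset.inter_subset_left, fun x hx => ?_⟩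
    have hx' : x ∈ U \ {v} := by grind
    have hsd : U \ (U ∩ {v}) = U \ {v} := by grind
    refine ⟨P x, hmem x hx', hsd ▸ hsub x hx', ?_, Y x, ⟨x, by simpa using hx', rfl⟩, (hY x hx').1⟩
    rw [Finset.disjoint_left] at hUX ⊢
    intro y hy
    have := hN x hx' hy
    grind
  have hR0 : H.outerNbrs U ∪ (U ∩ {v}) ⊆ X' ∩ cl U := by
    intro y hy; simp only [cl]; grind
  have hΦ0 : Φ (U, U ∩ {v}) ≤ 0 := by
    have h1 := card_outerNbrs_add (H := H) (W := U) (B := U ∩ {v}) Finset.inter_subset_left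
    have h2 := Finset.card_le_card hR0
    simp only [Φ]; omega
  obtain ⟨⟨W, B⟩, ⟨hUW, hWB⟩, hmin, hNW⟩ : ∃ p ∈ S, (∀ p' ∈ S, Φ p ≤ Φ p') ∧
      (H.outerNbrs p.1).card ≤ (X ∩ cl p.1).card := by
    obtain ⟨p, hp, hpmin⟩ := Set.exists_min_image S Φ (Set.toFinite _) ⟨_, h0⟩
    -- A negative minimum offsets the one cop by which `X'` may exceed `X`. Otherwise the starting
    -- pair is itself minimal, and `N(U) ⊆ X`.
    by_cases hneg : Φ p < 0
    · refine ⟨p, hp, hpmin, ?_⟩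
      have : (X' ∩ cl p.1).card ≤ (X ∩ cl p.1).card + 1 := by
        refine (Finset.card_le_card (t := insert v (X ∩ cl p.1)) (by grind)).trans
          (Finset.card_insert_le _ _)
      simp only [Φ] at hneg; omega
    · refine ⟨_, h0, fun p' hp' => by have := hpmin p' hp'; omega, Finset.card_le_card ?_⟩
      intro y hy; simp only [cl]; have := hNU hy; grind
  have hBW : B ⊆ W := hWB.1
  change U ⊆ W at hUW
  change (H.outerNbrs W).card ≤ (X ∩ cl W).card at hNW
  have hX'c : (X' ∩ cl W).card ≤ (X ∩ cl W).card + 1 :=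
    (Finset.card_le_card (t := insert v (X ∩ cl W)) (by grind)).trans (Finset.card_insert_le _ _)
  have hWB0 : (H.outerNbrs W).card + B.card ≤ (X' ∩ cl W).card := by
    have := hmin _ h0
    simp only [Φ] at this hΦ0; omega
  -- Exchanging a whole set `C` into the starting pair: what remains of its boundary and cut outside
  -- `N[C]` consists of cops and cancels in `Φ`. This bounds the placements needed inside `C`.
  have hle : ∀ C ∈ 𝒲, ((H.outerNbrs W).card : ℤ) + B.card - (X' ∩ cl W).card ≤
      (H.outerNbrs C).card - (X' ∩ cl C).card := by
    intro C hC
    have h1 := hmin (U ∪ C, _) ⟨Finset.subset_union_left, h0.2.exchange hC subset_rfl⟩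
    have h2 := card_exchange_le (H := H) (W := U) (B := U ∩ {v}) C Finset.inter_subset_left
    have h3 : ((H.outerNbrs U ∪ (U ∩ {v})) \ (C ∪ H.outerNbrs C)).card + (X' ∩ cl C).card ≤
        (X' ∩ cl (U ∪ C)).card := by
      rw [← Finset.card_union_of_disjoint (by rw [Finset.disjoint_left]; grind)]
      apply Finset.card_le_card
      intro y hy
      have := @hR0 y
      simp only [cl, Finset.mem_union, Finset.mem_inter, Finset.mem_sdiff, mem_outerNbrs]
        at this hy ⊢
      grind
    simp only [Φ] at h1; omega
  -- Exchanging `C ⊇ Q` into the minimal pair frees at least `N(Q)` from the boundary and cut and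
  -- adds at most `N(C)`. A smaller `N(C)` would therefore lower `Φ`.
  have hlink : ∀ Z ∈ 𝒲, ∀ Q ⊆ W \ B, Disjoint (H.outerNbrs Q) (W \ B) → ∀ C, Q ⊆ C → C ⊆ Z →
      (H.outerNbrs Q).card ≤ (H.outerNbrs C).card := by
    intro Z hZ Q hQ hQcl C hQC hCZ
    have h1 := hmin (W ∪ C, _) ⟨hUW.trans Finset.subset_union_left, hWB.exchange hZ hCZ⟩
    have h2 := card_exchange_le (H := H) (W := W) (B := B) C hBW
    have h3 : ((H.outerNbrs W ∪ B) \ (C ∪ H.outerNbrs C)).card + (H.outerNbrs Q).card ≤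
        (H.outerNbrs W ∪ B).card := by
      have hsub : H.outerNbrs Q ⊆ (H.outerNbrs W ∪ B) ∩ (C ∪ H.outerNbrs C) := by
        intro y hy
        have := Finset.disjoint_left.1 hQcl hy
        simp only [Finset.mem_union, Finset.mem_inter, Finset.mem_sdiff, mem_outerNbrs]
          at this hy ⊢
        grind
      have := Finset.card_le_card hsub
      have := Finset.card_sdiff_add_card_inter (H.outerNbrs W ∪ B) (C ∪ H.outerNbrs C)
      omega
    have h4 := card_outerNbrs_add (H := H) (W := W) (B := B) hBW
    have h5 : (X' ∩ cl W).card ≤ (X' ∩ cl (W ∪ C)).card := by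
      apply Finset.card_le_card
      intro y hy
      simp only [cl, Finset.mem_union, Finset.mem_inter, mem_outerNbrs] at hy ⊢
      grind
    simp only [Φ] at h1; omega
  have hWX : (X' ∩ cl W).card ≤ k := (Finset.card_le_card Finset.inter_subset_left).trans hk
  have hBd : (H.outerNbrs W).card + B.card ≤ (X ∩ cl W).card + 1 := hWB0.trans hX'c
  -- The number of placements is the largest that the budget in `Extends` allows; `hNW` keeps the
  -- subtraction from losing more than the `m + 1` placements permit.
  refine ⟨W, hUW, hNW, (X ∩ cl W).card + (m + 1) - (H.outerNbrs W).card, ?_, ?_⟩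
  · have hpc := hWB.2
    choose! R hxR hRW hRcl Z hZ hRZ using hpc
    refine .intro _ W B R hBW (by omega) (by omega) hxR hRW hRcl fun x hx => ?_
    obtain ⟨y, hy, hyZ⟩ := hZ x hx
    obtain ⟨-, -, d, hd, hdm⟩ := hY y (by simpa using hy)
    rw [hyZ] at hd hdm
    refine (hd.restrict (hRZ x hx) (hlink _ (hZ x hx) _ (hRW x hx) (hRcl x hx))).mono ?_
    have := hle _ (hZ x hx)
    simp only [cl] at *
    omega
  · simp only [cl] at *
    omega

end SimpleGraph

/-! ### Robber territories -/

namespace LoopGraph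

variable {V : Type*}

/-- The underlying simple graph. -/
def simple (G : LoopGraph V) : SimpleGraph V := SimpleGraph.fromEdgeSet G.edges

/-- The vertices outside `X` of the component in which the robber on `e` is. -/
def territory (G : LoopGraph V) (X : Set V) (e : Sym2 V) : Set V :=
  {y | ∃ (x y' : {v : V // v ∉ X}), x.1 ∈ e ∧ y'.1 = y ∧ (G.deleteVerts X).Reachable x y'}

theorem reachable_deleteVerts_mono (G : LoopGraph V) {X X' : Set V} (h : X' ⊆ X)
    {x y : {v : V // v ∉ X}} (hxy : (G.deleteVerts X).Reachable x y) :
    (G.deleteVerts X').Reachable ⟨x.1, fun hx => x.2 (h hx)⟩ ⟨y.1, fun hy => y.2 (h hy)⟩ :=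
  hxy.map (SimpleGraph.induceHomOfLE (SimpleGraph.fromEdgeSet G.edges)
    (s := {v | v ∉ X}) (s' := {v | v ∉ X'}) fun _ hv hv' => hv (h hv')).toHom

theorem territory_mono (G : LoopGraph V) {X X' : Set V} (h : X' ⊆ X) (e : Sym2 V) :
    G.territory X e ⊆ G.territory X' e := by
  rintro y ⟨x, y', hx, rfl, hr⟩
  exact ⟨_, _, hx, rfl, G.reachable_deleteVerts_mono h hr⟩

theorem notMem_of_mem_territory {G : LoopGraph V} {X : Set V} {e : Sym2 V} {y : V}
    (h : y ∈ G.territory X e) : y ∉ X := by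
  obtain ⟨x, y', hx, rfl, hr⟩ := h
  exact y'.2

theorem mem_territory_of_adj {G : LoopGraph V} {X : Set V} {e : Sym2 V} {y z : V}
    (h : y ∈ G.territory X e) (hz : z ∉ X) (hyz : G.simple.Adj y z) : z ∈ G.territory X e := by
  obtain ⟨x, y', hx, rfl, hr⟩ := h
  refine ⟨x, ⟨z, hz⟩, hx, rfl, hr.trans (SimpleGraph.Adj.reachable ?_)⟩
  exact hyz

theorem self_mem_territory {G : LoopGraph V} {X : Set V} {y : V} (hy : y ∉ X) :
    y ∈ G.territory X s(y, y) :=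
  ⟨⟨y, hy⟩, ⟨y, hy⟩, by simp, rfl, .rfl⟩

theorem territory_loop_subset {G : LoopGraph V} {X : Set V} {e : Sym2 V} {y : V}
    (h : y ∈ G.territory X e) : G.territory X s(y, y) ⊆ G.territory X e := by
  obtain ⟨x, y', hx, rfl, hr⟩ := h
  rintro z ⟨a, z', ha, rfl, hr'⟩
  have : a = y' := Subtype.ext (by simpa using ha)
  subst this
  exact ⟨x, z', hx, rfl, hr.trans hr'⟩

theorem loop_mem_edges_addLoops (G : LoopGraph V) (y : V) : s(y, y) ∈ G.addLoops.edges :=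
  Or.inr ⟨y, rfl⟩

theorem loop_mem_edgeComponent {G : LoopGraph V} {X : Set V} {e : Sym2 V} {y : V}
    (h : y ∈ G.addLoops.territory X e) : s(y, y) ∈ G.addLoops.edgeComponent X e := by
  obtain ⟨x, y', hx, rfl, hr⟩ := h
  exact ⟨G.loop_mem_edges_addLoops _, Or.inr ⟨x, y', hx, by simp, hr⟩⟩

end LoopGraph

/-! ### From a winning strategy to solvability -/

namespace CopStrategy

variable {V : Type*} [Fintype V] [DecidableEq V] {G : LoopGraph V} {k : ℕ}

theorem WinsFrom.exists_extends {σ : CopStrategy G.addLoops k} {q j : ℕ} {X : CopPos V k}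
    {e : G.addLoops.edges} (h : σ.WinsFrom q j X e) (U : Finset V)
    (hU : (U : Set V) = G.addLoops.territory X.1 e.1) :
    ∃ W, G.addLoops.simple.Extends k X.1 (q - j) U W := by
  induction h generalizing U with
  | captured j X e h =>
    have hU0 : U = ∅ := by
      rw [← Finset.coe_eq_empty, hU, Set.eq_empty_iff_forall_notMem]
      rintro y ⟨x, y', hx, rfl, hr⟩
      exact x.2 (h _ hx)
    have hN : G.addLoops.simple.outerNbrs ∅ = ∅ := by
      ext; simp [SimpleGraph.mem_outerNbrs]
    subst hU0
    exact ⟨∅, subset_rfl, by simp [hN], 0, .empty k 0, by simp [hN]⟩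
  | remove j X e hsub hwin ih =>
    -- It is enough that the robber stays on `e`: his territory only grows, so the same `W` serves.
    obtain ⟨W, hW⟩ := ih e ⟨e.2, Or.inl rfl⟩ (Set.toFinite _).toFinset (Set.Finite.coe_toFinset _)
    refine ⟨W, hW.mono ?_ hsub⟩
    rw [← Finset.coe_subset, hU, Set.Finite.coe_toFinset]
    exact G.addLoops.territory_mono (by exact_mod_cast hsub) _
  | place j X e v hj hins hwin ih =>
    set X' := σ.move X e with hX'
    have hXX' : X'.1 = insert v X.1 := by
      rw [← Finset.coe_inj, hins, Finset.coe_insert]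
    have hinter : (X.1 : Set V) ∩ X'.1 = X.1 := by rw [hins]; grind
    let P : V → Finset V := fun x =>
      (Set.toFinite (G.addLoops.territory (X'.1 : Set V) s(x, x))).toFinset
    have hPc : ∀ x, (P x : Set V) = G.addLoops.territory (X'.1 : Set V) s(x, x) :=
      fun x => Set.Finite.coe_toFinset _
    have hPm : ∀ x y, y ∈ P x ↔ y ∈ G.addLoops.territory (X'.1 : Set V) s(x, x) := by
      intro x y; rw [← hPc, Finset.mem_coe]
    have hUm : ∀ y, y ∈ U ↔ y ∈ G.addLoops.territory (X.1 : Set V) e.1 := by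
      intro y; rw [← hU, Finset.mem_coe]
    have hUX : ∀ y ∈ U, y ∉ X.1 := fun y hy =>
      LoopGraph.notMem_of_mem_territory ((hUm y).1 hy)
    have hjq : q - j = q - (j + 1) + 1 := by omega
    have hX'm : ∀ y, y ∈ (X'.1 : Set V) ↔ y = v ∨ y ∈ X.1 := by
      intro y; rw [hins]; simp
    rw [hjq]
    refine SimpleGraph.exists_extends_of_place (v := v) (hXX' ▸ X'.2)
      (Finset.disjoint_left.2 hUX) ?_ P ?_ ?_ ?_ ?_
    · intro y hy
      obtain ⟨hyU, x, hx, hxy⟩ := SimpleGraph.mem_outerNbrs.1 hy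
      by_contra hyX
      exact hyU ((hUm y).2 (LoopGraph.mem_territory_of_adj ((hUm x).1 hx) (by simpa using hyX) hxy))
    · intro x hx
      rw [hPm]
      exact LoopGraph.self_mem_territory (by rw [hX'm]; have := hUX x; grind)
    · intro x hx y hy
      rw [hPm] at hy
      have h1 := LoopGraph.notMem_of_mem_territory hy
      rw [hX'm] at h1
      rw [Finset.mem_sdiff] at hx ⊢
      refine ⟨(hUm y).2 (LoopGraph.territory_loop_subset ((hUm x).1 hx.1)
        (G.addLoops.territory_mono ?_ _ hy)), by grind⟩
      rw [hins]; exact Set.subset_insert _ _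
    · intro x hx y hy
      obtain ⟨hyU, z, hz, hzy⟩ := SimpleGraph.mem_outerNbrs.1 hy
      by_contra hyX
      refine hyU ((hPm x y).2 (LoopGraph.mem_territory_of_adj ((hPm x z).1 hz) ?_ hzy))
      rw [hX'm]; grind
    · intro x hx
      -- The loop at `x` is a legal robber move into the component of `x`; this is where the loops
      -- of `G°` enter.
      have := ih ⟨s(x, x), G.loop_mem_edges_addLoops x⟩ (by
        change _ ∈ G.addLoops.edgeComponent ((X.1 : Set V) ∩ X'.1) e.1
        rw [hinter]
        exact LoopGraph.loop_mem_edgeComponent ((hUm x).1 (by grind))) (P x) (hPc x)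
      rwa [hXX'] at this

theorem IsWinning.solvable {σ : CopStrategy G.addLoops k} {q : ℕ} (h : σ.IsWinning q) :
    G.addLoops.simple.Solvable k q Finset.univ := by
  have key : ∀ x, ∃ W : Finset V, x ∈ W ∧ G.addLoops.simple.outerNbrs W = ∅ ∧
      G.addLoops.simple.Solvable k q W := by
    intro x
    obtain ⟨W, hUW, hN, d, hd, hdq⟩ := (h ⟨s(x, x), G.loop_mem_edges_addLoops x⟩).exists_extends
      (Set.toFinite _).toFinset (Set.Finite.coe_toFinset _)
    simp only [CopPos.empty, Finset.empty_inter, Finset.card_empty] at hN hdq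
    refine ⟨W, hUW ?_, Finset.card_eq_zero.1 (by omega), hd.mono (by omega)⟩
    rw [Set.Finite.mem_toFinset]
    exact LoopGraph.self_mem_territory (by simp [CopPos.empty])
  choose W hxW hN hW using key
  have hNu : G.addLoops.simple.outerNbrs Finset.univ = ∅ := by
    ext; simp [SimpleGraph.mem_outerNbrs]
  exact .intro q _ ∅ W (by simp) (by simp [hNu]) (by simp) (fun x _ => hxW x) (by simp)
    (fun x _ => by simp [hN]) (fun x _ => by simpa using hW x)

end CopStrategy

/-! ### Trees given by parent functions -/

namespace SimpleGraph

/-- The graph in which every node is joined to its parent. -/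
def parentGraph {N : Type*} (par : N → N) : SimpleGraph N :=
  SimpleGraph.fromRel fun a b => par a = b

section parentGraph

variable {N : Type*} {r : N} {par : N → N} {rank : N → ℕ}

theorem parentGraph_adj_parent (hrank : ∀ n, n ≠ r → rank (par n) < rank n) {n : N} (hn : n ≠ r) :
    (parentGraph par).Adj n (par n) := by
  rw [parentGraph, fromRel_adj]
  refine ⟨fun h => ?_, Or.inl rfl⟩
  have := hrank n hn
  rw [← h] at this
  omega

/-- There is a path from the root to `t` along which a function that grows from parents to
children is bounded by its value at `t`. -/
theorem exists_isPath_of_parent [DecidableEq N] {α : Type*} [Preorder α]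
    (hrank : ∀ n, n ≠ r → rank (par n) < rank n)
    (Z : N → α) (hZ : ∀ n, Z (par n) ≤ Z n) (t : N) :
    ∃ p : (parentGraph par).Walk r t, p.IsPath ∧ ∀ s ∈ p.support, Z s ≤ Z t := by
  suffices ∃ p : (parentGraph par).Walk r t, ∀ s ∈ p.support, Z s ≤ Z t by
    obtain ⟨p, hp⟩ := this
    exact ⟨p.bypass, p.bypass_isPath, fun s hs => hp s (p.support_bypass_subset_support hs)⟩
  induction h : rank t using Nat.strong_induction_on generalizing t with
  | _ i ih =>
    by_cases ht : t = r
    · subst ht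
      exact ⟨.nil, by simp⟩
    · obtain ⟨p, hp⟩ := ih _ (h ▸ hrank t ht) (par t) rfl
      refine ⟨p.concat (parentGraph_adj_parent hrank ht).symm, fun s hs => ?_⟩
      rw [Walk.support_concat, List.mem_append, List.mem_singleton] at hs
      rcases hs with hs | rfl
      · exact (hp s hs).trans (hZ t)
      · exact le_rfl

/-- Descent along parents gives connectedness. Non-root nodes correspond to edges via their parent
edge, and two nodes cannot be parents of each other because the rank drops. -/
theorem parentGraph_isTree [Finite N] (hrank : ∀ n, n ≠ r → rank (par n) < rank n)
    (hr : par r = r) : (parentGraph par).IsTree := by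
  classical
  rw [isTree_iff_connected_and_card]
  constructor
  · have hreach (t : N) : (parentGraph par).Reachable r t :=
      ⟨(exists_isPath_of_parent hrank (fun _ => ()) (fun _ => le_rfl) t).choose⟩
    have : Nonempty N := ⟨r⟩
    exact ⟨fun a b => (hreach a).symm.trans (hreach b)⟩
  · have hbij : Function.Bijective (fun n : {n : N // n ≠ r} =>
        (⟨s(n.1, par n.1), parentGraph_adj_parent hrank n.2⟩ : (parentGraph par).edgeSet)) := by
      constructor
      · rintro ⟨a, ha⟩ ⟨b, hb⟩ hab
        have hab' : s(a, par a) = s(b, par b) := congrArg Subtype.val hab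
        rw [Sym2.eq_iff] at hab'
        rcases hab' with ⟨h, -⟩ | ⟨h1, h2⟩
        · exact Subtype.ext h
        · have h3 := hrank a ha
          have h4 := hrank b hb
          rw [h2] at h3
          rw [← h1] at h4
          omega
      · rintro ⟨e, he⟩
        induction e with | _ a b =>
        rw [mem_edgeSet, parentGraph, fromRel_adj] at he
        obtain ⟨hne, h | h⟩ := he
        · refine ⟨⟨a, fun har => hne ?_⟩, Subtype.ext (by simp [h])⟩
          rw [← h, har, hr]
        · refine ⟨⟨b, fun hbr => hne ?_⟩, Subtype.ext (by simp [h, Sym2.eq_swap])⟩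
          rw [← h, hbr, hr]
    rw [← Nat.card_eq_of_bijective _ hbij]
    have := Fintype.ofFinite N
    rw [Nat.card_eq_fintype_card, Nat.card_eq_fintype_card, Fintype.card_subtype_compl,
      Fintype.card_subtype_eq]
    have : 0 < Fintype.card N := Fintype.card_pos_iff.2 ⟨r⟩
    omega

theorem parentGraph_induce_connected (hrank : ∀ n, n ≠ r → rank (par n) < rank n) {S : Set N}
    {t : N} (ht : t ∈ S) (hS : ∀ n ∈ S, n = t ∨ n ≠ r ∧ par n ∈ S) :
    ((parentGraph par).induce S).Connected := by
  have hreach (n : N) (hn : n ∈ S) : ((parentGraph par).induce S).Reachable ⟨n, hn⟩ ⟨t, ht⟩ := by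
    induction h : rank n using Nat.strong_induction_on generalizing n with
    | _ i ih =>
      rcases hS n hn with rfl | ⟨hnr, hpar⟩
      · rfl
      · have hadj : ((parentGraph par).induce S).Adj ⟨n, hn⟩ ⟨par n, hpar⟩ :=
          parentGraph_adj_parent hrank hnr
        exact hadj.reachable.trans (ih _ (h ▸ hrank n hnr) (par n) hpar rfl)
  have : Nonempty S := ⟨⟨t, ht⟩⟩
  exact ⟨fun a b => (hreach a.1 a.2).trans (hreach b.1 b.2).symm⟩

end parentGraph

/-! ### Decompositions from monotone solvability -/

variable {V : Type*} [Fintype V] [DecidableEq V] {H : SimpleGraph V}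

/-- A tree decomposition, given by a parent function, of the graph of the edges with an end in `U`,
with bags of size at most `k`. The set `above n` contains all bags on the path from the root to `n`
and has size at most `m`. -/
structure RootedDecomposition (H : SimpleGraph V) (k m : ℕ) (U : Finset V) where
  Node : Type
  [fintypeNode : Fintype Node]
  root : Node
  par : Node → Node
  rank : Node → ℕ
  bag : Node → Finset V
  above : Node → Finset V
  par_root : par root = root
  rank_par : ∀ n, n ≠ root → rank (par n) < rank n
  card_bag : ∀ n, (bag n).card ≤ k
  outerNbrs_subset : H.outerNbrs U ⊆ bag root
  bag_subset : ∀ n, bag n ⊆ U ∪ H.outerNbrs U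
  connected : ∀ v ∈ U, ∃ t, v ∈ bag t ∧ ∀ n, v ∈ bag n → n = t ∨ n ≠ root ∧ v ∈ bag (par n)
  connected_root : ∀ v ∈ H.outerNbrs U, ∀ n, v ∈ bag n → n = root ∨ v ∈ bag (par n)
  adj_mem : ∀ a ∈ U, ∀ b, H.Adj a b → ∃ t, a ∈ bag t ∧ b ∈ bag t
  bag_subset_above : ∀ n, bag n ⊆ above n
  above_par : ∀ n, above (par n) ⊆ above n
  root_subset_above : ∀ n, bag root ⊆ above n
  card_above : ∀ n, (above n).card ≤ m

attribute [instance] RootedDecomposition.fintypeNode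

namespace RootedDecomposition

variable {k d : ℕ} {U B : Finset V} {n : ℕ} {Q : Fin n → Finset V}

/-- Decompositions for the parts of `U \ B` are joined at a new root with the bag `N(U) ∪ B`. -/
noncomputable def glue (hBU : B ⊆ U) (hk : (H.outerNbrs U).card + B.card ≤ k) (hd : B.card ≤ d)
    (hQU : ∀ i, Q i ⊆ U \ B) (hcover : ∀ x ∈ U \ B, ∃ i, x ∈ Q i)
    (hdisj : ∀ i j, i ≠ j → Disjoint (Q i) (Q j))
    (hcl : ∀ i, Disjoint (H.outerNbrs (Q i)) (U \ B))
    (D : ∀ i, H.RootedDecomposition k ((H.outerNbrs (Q i)).card + (d - B.card)) (Q i)) :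
    H.RootedDecomposition k ((H.outerNbrs U).card + d) U := by
  classical
  have hNQ : ∀ i, H.outerNbrs (Q i) ⊆ H.outerNbrs U ∪ B := by
    intro i y hy
    have h1 := Finset.disjoint_left.1 (hcl i) hy
    have h2 := hQU i
    rw [mem_outerNbrs] at hy
    simp only [Finset.mem_union, mem_outerNbrs]
    grind
  have hR : ∀ i, ∀ v ∈ Q i, v ∉ H.outerNbrs U ∪ B := by
    intro i v hv
    have h2 := hQU i hv
    simp only [Finset.mem_union, mem_outerNbrs]
    grind
  have hbagR : ∀ i (x : (D i).Node) (v), v ∈ (D i).bag x → v ∈ H.outerNbrs U ∪ B →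
      v ∈ H.outerNbrs (Q i) := by
    intro i x v hv hvR
    have h1 := (D i).bag_subset x hv
    have h2 := hR i v
    grind
  have hbagQ : ∀ i j (x : (D j).Node) (v), v ∈ Q i → v ∈ (D j).bag x → i = j := by
    intro i j x v hv hvx
    by_contra hij
    have h1 := (D j).bag_subset x hvx
    have h2 := Finset.disjoint_left.1 (hdisj i j hij) hv
    exact Finset.disjoint_left.1 (hcl j) (by grind) (hQU i hv)
  have hroot : ∀ v ∈ H.outerNbrs U ∪ B, ∀ i (x : (D i).Node), v ∈ (D i).bag x →
      x = (D i).root ∨ v ∈ (D i).bag ((D i).par x) := fun v hv i x hvx =>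
    (D i).connected_root v (hbagR i x v hvx hv) x hvx
  let bag : Option (Σ i, (D i).Node) → Finset V := fun x =>
    x.elim (H.outerNbrs U ∪ B) fun p => (D p.1).bag p.2
  let par : Option (Σ i, (D i).Node) → Option (Σ i, (D i).Node) := fun x =>
    x.elim none fun p => if p.2 = (D p.1).root then none else some ⟨p.1, (D p.1).par p.2⟩
  have hpar_root : ∀ i, par (some ⟨i, (D i).root⟩) = none := fun i => by simp [par]
  have hpar : ∀ i x, x ≠ (D i).root → par (some ⟨i, x⟩) = some ⟨i, (D i).par x⟩ :=
    fun i x hx => by simp [par, hx]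
  have hRconn : ∀ v ∈ H.outerNbrs U ∪ B, ∀ m, v ∈ bag m → m = none ∨ m ≠ none ∧ v ∈ bag (par m) := by
    rintro v hv (_ | ⟨i, x⟩) hvm
    · exact Or.inl rfl
    · refine Or.inr ⟨by simp, ?_⟩
      by_cases hx : x = (D i).root
      · subst hx; rw [hpar_root]; exact hv
      · rw [hpar i x hx]
        exact (hroot v hv i x hvm).resolve_left hx
  refine
    { Node := Option (Σ i, (D i).Node)
      root := none
      par := par
      rank := fun x => x.elim 0 fun p => (D p.1).rank p.2 + 1
      bag := bag
      above := fun x => x.elim (H.outerNbrs U ∪ B) fun p => (H.outerNbrs U ∪ B) ∪ (D p.1).above p.2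
      par_root := rfl
      rank_par := ?_
      card_bag := ?_
      outerNbrs_subset := Finset.subset_union_left
      bag_subset := ?_
      connected := ?_
      connected_root := ?_
      adj_mem := ?_
      bag_subset_above := ?_
      above_par := ?_
      root_subset_above := ?_
      card_above := ?_ }
  · rintro (_ | ⟨i, x⟩) h
    · exact absurd rfl h
    · by_cases hx : x = (D i).root
      · subst hx; rw [hpar_root]; simp
      · rw [hpar i x hx]
        simpa using (D i).rank_par x hx
  · rintro (_ | ⟨i, x⟩)
    · exact (Finset.card_union_le _ _).trans hk
    · exact (D i).card_bag x
  · rintro (_ | ⟨i, x⟩)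
    · simp only [bag, Option.elim]; grind
    · refine ((D i).bag_subset x).trans ?_
      have h1 := hQU i
      have h2 := hNQ i
      grind
  · intro v hv
    by_cases hvB : v ∈ B
    · have hvR : v ∈ H.outerNbrs U ∪ B := Finset.mem_union_right _ hvB
      exact ⟨none, hvR, hRconn v hvR⟩
    · obtain ⟨i, hi⟩ := hcover v (by grind)
      obtain ⟨t, htv, ht⟩ := (D i).connected v hi
      refine ⟨some ⟨i, t⟩, htv, ?_⟩
      rintro (_ | ⟨j, x⟩) hvx
      · exact absurd hvx (hR i v hi)
      · obtain rfl := hbagQ i j x v hi hvx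
        rcases ht x hvx with rfl | ⟨hx, hvp⟩
        · exact Or.inl rfl
        · refine Or.inr ⟨by simp, ?_⟩
          rw [hpar i x hx]
          exact hvp
  · intro v hv m hvm
    exact (hRconn v (Finset.mem_union_left _ hv) m hvm).imp_right And.right
  · have hin : ∀ i, ∀ a ∈ Q i, ∀ b, H.Adj a b → ∃ t, a ∈ bag t ∧ b ∈ bag t := by
      intro i a ha b hab
      obtain ⟨t, h1, h2⟩ := (D i).adj_mem a ha b hab
      exact ⟨some ⟨i, t⟩, h1, h2⟩
    intro a ha b hab
    by_cases haB : a ∈ B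
    · by_cases hb : b ∈ U \ B
      · obtain ⟨i, hi⟩ := hcover b hb
        obtain ⟨t, h1, h2⟩ := hin i b hi a hab.symm
        exact ⟨t, h2, h1⟩
      · refine ⟨none, Finset.mem_union_right _ haB, ?_⟩
        change b ∈ H.outerNbrs U ∪ B
        simp only [Finset.mem_union, mem_outerNbrs]
        grind
    · obtain ⟨i, hi⟩ := hcover a (by grind)
      exact hin i a hi b hab
  · rintro (_ | ⟨i, x⟩)
    · exact subset_rfl
    · exact ((D i).bag_subset_above x).trans Finset.subset_union_right
  · rintro (_ | ⟨i, x⟩)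
    · exact subset_rfl
    · by_cases hx : x = (D i).root
      · subst hx; rw [hpar_root]
        exact Finset.subset_union_left
      · rw [hpar i x hx]
        exact Finset.union_subset_union_right ((D i).above_par x)
  · rintro (_ | ⟨i, x⟩)
    · exact subset_rfl
    · exact Finset.subset_union_left
  · rintro (_ | ⟨i, x⟩)
    · exact (Finset.card_union_le _ _).trans (Nat.add_le_add_left hd _)
    -- The new root bag and the old path union share `N(Q i)`, so this part of the inductive bound
    -- is not counted twice.
    · have h1 : H.outerNbrs (Q i) ⊆ (H.outerNbrs U ∪ B) ∩ (D i).above x :=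
        Finset.subset_inter (hNQ i)
          ((D i).outerNbrs_subset.trans ((D i).root_subset_above x))
      have h2 := Finset.card_le_card h1
      have h3 := Finset.card_union_add_card_inter (H.outerNbrs U ∪ B) ((D i).above x)
      have h4 := (D i).card_above x
      have h5 := Finset.card_union_le (H.outerNbrs U) B
      change ((H.outerNbrs U ∪ B) ∪ (D i).above x).card ≤ _
      omega

end RootedDecomposition

/-- The claim is made for every union `Q` of components of `U` since the sets `P x` may overlap and
must be cut down to disjoint parts before gluing. -/
theorem Solvable.nonempty_rootedDecomposition {k d : ℕ} {U : Finset V} (h : H.Solvable k d U) :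
    ∀ Q ⊆ U, Disjoint (H.outerNbrs Q) U →
      Nonempty (H.RootedDecomposition k ((H.outerNbrs Q).card + d) Q) := by
  induction h with
  | intro d U B P hBU hk hB hmem hsub hclosed hP ih =>
    intro Q hQU hQ
    have hcl : ∀ x ∈ U \ B, ∀ y ∈ U \ B, ∀ z ∈ U \ B, H.Adj y z → y ∈ P x → z ∈ P x := by
      intro x hx y hy z hz hyz hyP
      by_contra hzP
      exact Finset.disjoint_left.1 (hclosed x hx) (mem_outerNbrs.2 ⟨hzP, y, hyP, hyz⟩) hz
    have hQcl : ∀ y ∈ Q, ∀ z ∈ U, H.Adj y z → z ∈ Q := by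
      intro y hy z hz hyz
      by_contra hzQ
      exact Finset.disjoint_left.1 hQ (mem_outerNbrs.2 ⟨hzQ, y, hy, hyz⟩) hz
    have hNQ : (H.outerNbrs Q).card ≤ (H.outerNbrs U).card := by
      refine Finset.card_le_card fun y hy => ?_
      have := Finset.disjoint_left.1 hQ hy
      rw [mem_outerNbrs] at hy ⊢
      grind
    -- Each part drops what earlier parts cover and stays closed under adjacency in `U \ B`.
    -- Indexing by `Fin` also keeps the nodes in `Type`, whatever the universe of `V`.
    let e := (U \ B).equivFin.symm
    let R : Fin (U \ B).card → Finset V := fun i =>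
      {y ∈ P (e i) ∩ Q | ∀ j < i, y ∉ P (e j)}
    have hR : ∀ i y, y ∈ R i ↔ (y ∈ P (e i) ∧ y ∈ Q) ∧ ∀ j < i, y ∉ P (e j) := by
      intro i y; simp only [R, Finset.mem_filter, Finset.mem_inter]
    have hRU : ∀ i, R i ⊆ U \ B := fun i y hy => hsub _ (e i).2 ((hR i y).1 hy).1.1
    have hRcl : ∀ i, Disjoint (H.outerNbrs (R i)) (U \ B) := by
      intro i
      rw [Finset.disjoint_left]
      intro y hy hyU
      obtain ⟨hyR, z, hz, hzy⟩ := mem_outerNbrs.1 hy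
      have hzU := hRU i hz
      obtain ⟨⟨hzP, hzQ⟩, hzj⟩ := (hR i z).1 hz
      exact hyR ((hR i y).2 ⟨⟨hcl _ (e i).2 z hzU y hyU hzy hzP,
        hQcl z hzQ y (Finset.mem_sdiff.1 hyU).1 hzy⟩,
        fun j hj hyj => hzj j hj (hcl _ (e j).2 y hyU z hzU hzy.symm hyj)⟩)
    have hBQ : (B ∩ Q).card ≤ B.card := Finset.card_le_card Finset.inter_subset_left
    have D : ∀ i, Nonempty (H.RootedDecomposition k
        ((H.outerNbrs (R i)).card + (d - (B ∩ Q).card)) (R i)) := by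
      intro i
      obtain ⟨D⟩ := ih (e i) (e i).2 (R i) (fun y hy => ((hR i y).1 hy).1.1)
        ((hRcl i).mono_right (hsub _ (e i).2))
      exact ⟨{ D with card_above := fun n => (D.card_above n).trans (by omega) }⟩
    refine ⟨RootedDecomposition.glue (B := B ∩ Q) (Q := R) Finset.inter_subset_right (by omega)
      (by omega) ?_ ?_ ?_ ?_ fun i => (D i).some⟩
    · intro i y hy
      have h1 := hRU i hy
      have h2 := (hR i y).1 hy
      grind
    · intro x hx
      have hxU : x ∈ U \ B := by grind
      have hex : ∃ i, x ∈ P (e i) := ⟨e.symm ⟨x, hxU⟩, by simpa using hmem x hxU⟩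
      obtain ⟨i, hi, hmin⟩ := Set.exists_min_image {i | x ∈ P (e i)} id (Set.toFinite _) hex
      refine ⟨i, (hR i x).2 ⟨⟨hi, by grind⟩, fun j hj hxj => ?_⟩⟩
      exact absurd (hmin j hxj) (not_le.2 hj)
    · intro i j hij
      rw [Finset.disjoint_left]
      intro y hyi hyj
      have h1 := (hR i y).1 hyi
      have h2 := (hR j y).1 hyj
      rcases lt_or_gt_of_ne hij with h | h
      · exact h2.2 i h h1.1.1
      · exact h1.2 j h h2.1.1
    · intro i
      exact (hRcl i).mono_right (by grind)

end SimpleGraph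

/-! ### The tree decomposition of the graph -/

namespace LoopGraph

open SimpleGraph

variable {V : Type*} [Fintype V] [DecidableEq V]

/-- A rooted decomposition of the whole graph is a tree decomposition. -/
def treeDecompositionOfRooted {G : LoopGraph V} {k m : ℕ}
    (D : G.addLoops.simple.RootedDecomposition k m Finset.univ) : TreeDecomposition G where
  Node := D.Node
  tree := parentGraph D.par
  isTree := parentGraph_isTree D.rank_par D.par_root
  root := D.root
  bag := D.bag
  vertex_mem v := by
    obtain ⟨t, ht, -⟩ := D.connected v (Finset.mem_univ v)
    exact ⟨t, ht⟩
  edge_mem e he := by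
    induction e with | _ a b =>
    by_cases hab : a = b
    · subst hab
      obtain ⟨t, ht, -⟩ := D.connected a (Finset.mem_univ a)
      exact ⟨t, by simpa using ht⟩
    · obtain ⟨t, ha, hb⟩ := D.adj_mem a (Finset.mem_univ a) b
        ((SimpleGraph.fromEdgeSet_adj _).2 ⟨Or.inl he, hab⟩)
      exact ⟨t, by simp [ha, hb]⟩
  connected v := by
    obtain ⟨t, ht, h⟩ := D.connected v (Finset.mem_univ v)
    exact parentGraph_induce_connected D.rank_par ht h

theorem width_treeDecompositionOfRooted_le {G : LoopGraph V} {k m : ℕ}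
    (D : G.addLoops.simple.RootedDecomposition k m Finset.univ) :
    (treeDecompositionOfRooted D).width ≤ (k : ℤ) - 1 := by
  have : (Finset.univ.sup fun t => ((treeDecompositionOfRooted D).bag t).card) ≤ k :=
    Finset.sup_le fun t _ => D.card_bag t
  unfold TreeDecomposition.width
  omega

theorem depth_treeDecompositionOfRooted_le {G : LoopGraph V} {k m : ℕ}
    (D : G.addLoops.simple.RootedDecomposition k m Finset.univ) :
    (treeDecompositionOfRooted D).depth ≤ m := by
  classical
  refine Finset.sup_le fun t _ => ?_
  have hsub : (treeDecompositionOfRooted D).pathUnion t ⊆ (D.above t : Set V) := by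
    rintro v ⟨p, hp, s, hs, hv⟩
    obtain ⟨p', hp', hZ⟩ := exists_isPath_of_parent D.rank_par D.above D.above_par t
    have hpp : p = p' := ((treeDecompositionOfRooted D).isTree.existsUnique_path D.root t).unique
      hp hp'
    subst hpp
    exact hZ s hs (D.bag_subset_above s hv)
  exact (Set.ncard_le_ncard hsub (Finset.finite_toSet _)).trans
    ((Set.ncard_coe_finset _).trans_le (D.card_above t))

end LoopGraph

theorem mainTheorem2 {V : Type*} [Finite V] (G : LoopGraph V) (k q : ℕ) (hk : 1 ≤ k) (hq : 1 ≤ q)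
    (σ : CopStrategy G.addLoops k) (hσ : σ.IsWinning q) :
    ∃ D : TreeDecomposition G, D.width ≤ (k : ℤ) - 1 ∧ D.depth ≤ q := by
  classical
  have := Fintype.ofFinite V
  have hN : G.addLoops.simple.outerNbrs Finset.univ = ∅ := by
    ext; simp [SimpleGraph.mem_outerNbrs]
  obtain ⟨D⟩ := hσ.solvable.nonempty_rootedDecomposition Finset.univ subset_rfl (by simp [hN])
  rw [hN, Finset.card_empty, zero_add] at D
  exact ⟨LoopGraph.treeDecompositionOfRooted D, LoopGraph.width_treeDecompositionOfRooted_le D,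
    LoopGraph.depth_treeDecompositionOfRooted_le D⟩
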